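/- Let $q\ge 3$ be a prime power with $q\neq 4$, let $k\ge 2$ be an integer, and put $t=\lfloor (k+2)/4\rfloor$. Let $D(k,q)$ be the bipartite graph whose vertex set is the disjoint union of two copies of $\mathbb{F}_q^k$, the points $(p)=(p_1,\dots,p_k)$ and the lines $[l]=[l_1,\dots,l_k]$, in which a point $(p)$ and a line $[l]$ are adjacent if and only if $p_i+l_i=f_i$ for all $2\le i\le k$, where $f_2=p_1l_1$, $f_3=p_1l_2$ and, for $4\le i\le k$, $$f_i=\begin{cases}p_{i-2}\,l_1, & i\equiv 0 \text{ or } 1 \pmod 4,\\ p_1\,l_{i-2}, & i\equiv 2 \text{ or } 3 \pmod 4.\end{cases}$$ Then $D(k,q)$ has exactly $q^{t-1}$ connected components. -/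

import Mathlib

namespace DGraph

/-- The `i`-th coordinate, counted from `1`, of a vector `v = (v_1, …, v_k)` of length `k`.
The value for `i` outside `{1, …, k}` is never used below. -/
def coord {F : Type*} [Zero F] {k : ℕ} (v : Fin k → F) (i : ℕ) : F :=
  if h : 1 ≤ i ∧ i ≤ k then v ⟨i - 1, by omega⟩ else 0

/-- The right-hand side `f_i` of the `i`-th defining relation, `i ≥ 2`:
`f_2 = p_1 l_1`, `f_3 = p_1 l_2`, and, for `i ≥ 4`, `f_i = p_{i-2} l_1` if `i ≡ 0, 1 (mod 4)`
and `f_i = p_1 l_{i-2}` if `i ≡ 2, 3 (mod 4)`. -/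
def rhs {F : Type*} [Field F] {k : ℕ} (i : ℕ) (p l : Fin k → F) : F :=
  if i = 2 then coord p 1 * coord l 1
  else if i = 3 then coord p 1 * coord l 2
  else if i % 4 = 0 ∨ i % 4 = 1 then coord p (i - 2) * coord l 1
  else coord p 1 * coord l (i - 2)

/-- The point `(p)` and the line `[l]` satisfy the `k - 1` relations
`p_i + l_i = f_i`, `2 ≤ i ≤ k`. -/
def Incident {F : Type*} [Field F] {k : ℕ} (p l : Fin k → F) : Prop :=
  ∀ i : ℕ, 2 ≤ i → i ≤ k → coord p i + coord l i = rhs i p l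

/-- The bipartite graph `D(k, F)`; for `F` the field with `q` elements this is `D(k, q)`.
The vertices `Sum.inl p` are the points `(p)` and the vertices `Sum.inr l` the lines `[l]`. -/
def D (k : ℕ) (F : Type*) [Field F] : SimpleGraph ((Fin k → F) ⊕ (Fin k → F)) where
  Adj
    | Sum.inl p, Sum.inr l => Incident p l
    | Sum.inr l, Sum.inl p => Incident p l
    | Sum.inl _, Sum.inl _ => False
    | Sum.inr _, Sum.inr _ => False
  symm := ⟨by
    rintro (a | a) (b | b) h
    · exact h
    · exact h
    · exact h
    · exact h⟩
  loopless := ⟨by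
    rintro (a | a) h
    · exact h
    · exact h⟩

end DGraph

/-! An edge of the graph is read off from a flag: a 2×2 matrix over `F⟦X⟧`, upper unitriangular
modulo `X`, whose determinant has no linear term. Right multiplication by `upper (C a)` fixes the
point of a flag and by `lower (C a)` fixes its line, so the group generated by these matrices moves
a flag inside its component.

That group is dense in `unip F` (`eq_top_of_upper_lower`). Modulo `X ^ N` the group `unip F` becomes
a finite p-group, so density can be tested on homomorphisms to abelian groups (`hom_eq_one`); this
is where the conditions on q enter. Two flags with equal determinant differ by an element of `unip
F`, hence lie in one component (`reachable_of_det_eq`).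

Conversely, the determinant modulo `X ^ (t + 1)` is constant along edges (`X_pow_dvd_det_sub`). Its
coefficients in degrees 0 and 1 are 1 and 0, and those in degrees 2, …, t are arbitrary
(`inv_surjective`), which leaves t - 1 free parameters in `F`. -/

open PowerSeries Matrix

universe u v

/-! ### Generation of p-groups modulo commutators -/

/-- A subgroup containing the kernel of a homomorphism onto a finite `p`-group is everything as
soon as it generates the abelianization. -/
theorem Subgroup.eq_top_of_forall_commGroup_hom {G : Type u} {Q : Type v} [Group G] [Group Q] [Finite Q]
    {p : ℕ} [Fact p.Prime] (hQ : IsPGroup p Q) (f : G →* Q) (hf : Function.Surjective f)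
    (S : Subgroup G) (hk : f.ker ≤ S)
    (H : ∀ (A : Type v) [CommGroup A] (φ : G →* A), S ≤ φ.ker → φ = 1) : S = ⊤ := by
  -- A proper image lies in a maximal subgroup `K`, normal by nilpotency. The center of `Q ⧸ K` is
  -- nontrivial, so by maximality of `K` the quotient is abelian, and the map to it kills `S`
  -- without being trivial.
  rcases eq_top_or_exists_le_coatom (S.map f) with h | ⟨K, hK, hSK⟩
  · have := Subgroup.comap_map_eq f S
    rw [h, Subgroup.comap_top, sup_eq_left.2 hk] at this
    exact this.symm
  · exfalso
    have hnil : Group.IsNilpotent Q := hQ.isNilpotent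
    have hn : K.Normal := Subgroup.NormalizerCondition.normal_of_coatom K
      Group.normalizerCondition_of_isNilpotent hK
    have hnt : Nontrivial (Q ⧸ K) := by
      rw [← not_subsingleton_iff_nontrivial]
      intro h
      exact hK.1 (QuotientGroup.subgroup_eq_top_of_subsingleton K h)
    have hc : Nontrivial (Subgroup.center (Q ⧸ K)) := (hQ.to_quotient K).center_nontrivial
    have hle : K ≤ (Subgroup.center (Q ⧸ K)).comap (QuotientGroup.mk' K) := by
      intro x hx
      have : QuotientGroup.mk' K x = 1 := (QuotientGroup.eq_one_iff x).2 hx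
      simp only [Subgroup.mem_comap, this, one_mem]
    have htop : Subgroup.center (Q ⧸ K) = ⊤ := by
      rcases hle.eq_or_lt with h | h
      · exfalso
        obtain ⟨⟨z, hz⟩, hz1⟩ := exists_ne (1 : Subgroup.center (Q ⧸ K))
        obtain ⟨x, rfl⟩ := QuotientGroup.mk'_surjective K z
        have hx : x ∈ K := by rw [h]; exact hz
        exact hz1 (Subtype.ext ((QuotientGroup.eq_one_iff x).2 hx))
      · have := hK.2 _ h
        rw [eq_top_iff]
        intro z _
        obtain ⟨x, rfl⟩ := QuotientGroup.mk'_surjective K z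
        have hx : x ∈ (Subgroup.center (Q ⧸ K)).comap (QuotientGroup.mk' K) := by
          rw [this]; trivial
        exact hx
    let _ : CommGroup (Q ⧸ K) := Group.commGroupOfCenterEqTop htop
    have h1 := H (Q ⧸ K) ((QuotientGroup.mk' K).comp f) (by
      intro s hs
      exact (QuotientGroup.eq_one_iff (f s)).2 (hSK (Subgroup.mem_map_of_mem f hs)))
    obtain ⟨z, hz⟩ := exists_ne (1 : Q ⧸ K)
    obtain ⟨x, rfl⟩ := QuotientGroup.mk'_surjective K z
    obtain ⟨g, rfl⟩ := hf x
    exact hz (DFunLike.congr_fun h1 g)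

/-! ### The group `unip F` and its triangular decomposition -/

namespace DGraph

variable {F : Type*} [Field F]

/-- The matrices of determinant one over `F⟦X⟧` that are unipotent upper triangular modulo `X`. -/
def unip (F : Type*) [Field F] : Subgroup (SpecialLinearGroup (Fin 2) F⟦X⟧) where
  carrier := {g | constantCoeff (g 0 0) = 1 ∧ constantCoeff (g 1 1) = 1 ∧
    constantCoeff (g 1 0) = 0}
  one_mem' := by simp
  mul_mem' := by
    rintro g h ⟨h1, h2, h3⟩ ⟨h4, h5, h6⟩
    simp [Matrix.mul_apply, Fin.sum_univ_two, h1, h2, h3, h4, h5, h6]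
  inv_mem' := by
    rintro g ⟨h1, h2, h3⟩
    simp [Matrix.adjugate_fin_two, h1, h2, h3]

/-- The underlying matrix. -/
def mat (g : unip F) : Matrix (Fin 2) (Fin 2) F⟦X⟧ := (g : SpecialLinearGroup (Fin 2) F⟦X⟧)

theorem unip_ext {g h : unip F} (h00 : mat g 0 0 = mat h 0 0) (h01 : mat g 0 1 = mat h 0 1)
    (h10 : mat g 1 0 = mat h 1 0) (h11 : mat g 1 1 = mat h 1 1) : g = h := by
  apply Subtype.ext
  apply Subtype.ext
  ext i j : 1
  fin_cases i <;> fin_cases j <;> assumption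

theorem mat_mul (g h : unip F) : mat (g * h) = mat g * mat h := rfl

theorem mat_one : mat (1 : unip F) = 1 := rfl

theorem mat_pow (g : unip F) (n : ℕ) : mat (g ^ n) = mat g ^ n := by
  induction n with
  | zero => rw [pow_zero, pow_zero, mat_one]
  | succ n ih => rw [pow_succ, pow_succ, mat_mul, ih]

theorem det_mat (g : unip F) : (mat g).det = 1 := g.1.2

theorem mat_entries (g : unip F) : constantCoeff (mat g 0 0) = 1 ∧
    constantCoeff (mat g 1 1) = 1 ∧ constantCoeff (mat g 1 0) = 0 := g.2

/-- The element of `unip F` with a given matrix. -/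
def ofMat (g : Matrix (Fin 2) (Fin 2) F⟦X⟧) (hd : g.det = 1) (h0 : constantCoeff (g 0 0) = 1)
    (h1 : constantCoeff (g 1 1) = 1) (h2 : constantCoeff (g 1 0) = 0) : unip F :=
  ⟨⟨g, hd⟩, h0, h1, h2⟩

theorem mat_ofMat (g : Matrix (Fin 2) (Fin 2) F⟦X⟧) (hd : g.det = 1)
    (h0 : constantCoeff (g 0 0) = 1) (h1 : constantCoeff (g 1 1) = 1)
    (h2 : constantCoeff (g 1 0) = 0) : mat (ofMat g hd h0 h1 h2) = g := rfl

/-- The upper unitriangular matrix with entry `x`. -/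
noncomputable def upper (x : F⟦X⟧) : unip F :=
  ofMat !![1, x; 0, 1] (by simp [Matrix.det_fin_two]) (by simp) (by simp) (by simp)

theorem mat_upper (x : F⟦X⟧) : mat (upper x) = !![1, x; 0, 1] := rfl

/-- The lower unitriangular matrix with entry `X * y`. -/
noncomputable def lower (y : F⟦X⟧) : unip F :=
  ofMat !![1, 0; X * y, 1] (by simp [Matrix.det_fin_two]) (by simp) (by simp) (by simp)

theorem mat_lower (y : F⟦X⟧) : mat (lower y) = !![1, 0; X * y, 1] := rfl

theorem one_add_X_mul_inv (v : F⟦X⟧) : (1 + X * v) * (1 + X * v)⁻¹ = 1 :=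
  PowerSeries.mul_inv_cancel _ (by simp)

/-- The diagonal matrix with first entry `1 + X * v`. -/
noncomputable def torus (v : F⟦X⟧) : unip F :=
  ofMat !![1 + X * v, 0; 0, (1 + X * v)⁻¹]
    (by rw [Matrix.det_fin_two_of, one_add_X_mul_inv]; ring) (by simp) (by simp) (by simp)

theorem mat_torus (v : F⟦X⟧) : mat (torus v) = !![1 + X * v, 0; 0, (1 + X * v)⁻¹] := rfl

theorem upper_mul (x y : F⟦X⟧) : upper x * upper y = upper (x + y) := by
  apply unip_ext <;> simp [mat_mul, mat_upper, Matrix.mul_apply, Fin.sum_univ_two, add_comm]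

theorem lower_mul (x y : F⟦X⟧) : lower x * lower y = lower (x + y) := by
  apply unip_ext <;> simp [mat_mul, mat_lower, Matrix.mul_apply, Fin.sum_univ_two, mul_add]

theorem torus_mul_upper (v x : F⟦X⟧) :
    torus v * upper x = upper ((1 + X * v) ^ 2 * x) * torus v := by
  have h := one_add_X_mul_inv v
  apply unip_ext <;> simp [mat_mul, mat_upper, mat_torus, Matrix.mul_apply, Fin.sum_univ_two]
  linear_combination (-(1 + X * v) * x) * h

theorem lower_mul_torus (v y : F⟦X⟧) :
    lower y * torus v = torus v * lower ((1 + X * v) ^ 2 * y) := by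
  have h := one_add_X_mul_inv v
  apply unip_ext <;> simp [mat_mul, mat_lower, mat_torus, Matrix.mul_apply, Fin.sum_univ_two]
  linear_combination (-(1 + X * v) * X * y) * h

theorem upper_mul_lower (x y : F⟦X⟧) :
    upper x * lower y = lower (y * (1 + X * (x * y))⁻¹) * torus (x * y) *
      upper (x * (1 + X * (x * y))⁻¹) := by
  have h := one_add_X_mul_inv (x * y)
  apply unip_ext <;> simp [mat_mul, mat_lower, mat_upper, mat_torus, Matrix.mul_apply, Fin.sum_univ_two]
  · ring
  · linear_combination (-x) * h
  · linear_combination (-X * y) * h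
  · linear_combination (-1 - X * x * y * (1 + X * (x * y))⁻¹) * h

/-- The upper left entry is 1 modulo `X`, hence a unit, so Gaussian elimination works; the last
entry is forced by the determinant. -/
theorem eq_lower_mul_torus_mul_upper (g : unip F) :
    ∃ x v y, g = lower y * torus v * upper x := by
  obtain ⟨h1, h2, h3⟩ := mat_entries g
  have hd := det_mat g
  rw [Matrix.det_fin_two] at hd
  obtain ⟨v, hv⟩ := X_dvd_iff.2 (show constantCoeff (mat g 0 0 - 1) = 0 by simp [h1])
  obtain ⟨w, hw⟩ := X_dvd_iff.2 h3
  have ha : mat g 0 0 = 1 + X * v := by rw [← hv]; ring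
  have h := one_add_X_mul_inv v
  rw [ha, hw] at hd
  refine ⟨mat g 0 1 * (1 + X * v)⁻¹, v, w * (1 + X * v)⁻¹, ?_⟩
  apply unip_ext <;> simp [mat_mul, mat_lower, mat_upper, mat_torus, Matrix.mul_apply, Fin.sum_univ_two]
  · exact ha
  · linear_combination (-mat g 0 1) * h
  · rw [hw]; linear_combination (-X * w) * h
  · linear_combination (1 + X * v)⁻¹ * hd -
      (X * w * (mat g 0 1) * (1 + X * v)⁻¹ + mat g 1 1) * h

theorem exists_eq_C_add_X_mul (x : F⟦X⟧) : ∃ a z, x = C a + X * z := by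
  obtain ⟨z, hz⟩ := X_dvd_iff.2 (show constantCoeff (x - C (constantCoeff x)) = 0 by simp)
  exact ⟨constantCoeff x, z, by rw [← hz]; ring⟩

/-! ### Homomorphisms from `unip F` to abelian groups -/

section Hom

variable {A : Type*} [CommGroup A] (φ : unip F →* A)

theorem map_upper_add (x y : F⟦X⟧) : φ (upper (x + y)) = φ (upper x) * φ (upper y) := by
  rw [← upper_mul, map_mul]

theorem map_lower_add (x y : F⟦X⟧) : φ (lower (x + y)) = φ (lower x) * φ (lower y) := by
  rw [← lower_mul, map_mul]

/-- Conjugation by `torus v` is invisible in an abelian group, and it changes `x` by `(1 + X * v) ^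
2 * x - x`. -/
theorem map_upper_torus (v x : F⟦X⟧) : φ (upper ((2 + X * v) * X * v * x)) = 1 := by
  have h := congrArg φ (torus_mul_upper v x)
  rw [map_mul, map_mul, mul_comm] at h
  have h2 := mul_right_cancel h
  rw [show (1 + X * v) ^ 2 * x = x + (2 + X * v) * X * v * x by ring, map_upper_add] at h2
  exact (mul_eq_left.1 h2.symm)

theorem map_lower_torus (v x : F⟦X⟧) : φ (lower ((2 + X * v) * X * v * x)) = 1 := by
  have h := congrArg φ (lower_mul_torus v x)
  rw [map_mul, map_mul, mul_comm] at h
  have h2 := mul_left_cancel h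
  rw [show (1 + X * v) ^ 2 * x = x + (2 + X * v) * X * v * x by ring, map_lower_add] at h2
  exact (mul_eq_left.1 h2.symm)

theorem hom_eq_one_of_upper_lower (hu : ∀ x, φ (upper x) = 1) (hl : ∀ y, φ (lower y) = 1) :
    φ = 1 := by
  have ht : ∀ v, φ (torus v) = 1 := by
    intro v
    have h := congrArg φ (upper_mul_lower 1 v)
    simpa [hu, hl] using h.symm
  ext g
  obtain ⟨x, v, y, rfl⟩ := eq_lower_mul_torus_mul_upper g
  simp [hu, hl, ht]

/-- For `v = 1` the factor `2 + X` is a unit, so the torus relations already kill every multiple of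
`X`. -/
theorem hom_eq_one_of_two_ne_zero (h2 : (2 : F) ≠ 0) (hu : ∀ a, φ (upper (C a)) = 1)
    (hl : ∀ a, φ (lower (C a)) = 1) : φ = 1 := by
  have hinv : (2 + X * 1 : F⟦X⟧) * (2 + X * 1)⁻¹ = 1 := PowerSeries.mul_inv_cancel _ (by
    rw [map_add, map_mul, map_ofNat]; simpa using h2)
  apply hom_eq_one_of_upper_lower
  · intro x
    obtain ⟨a, z, rfl⟩ := exists_eq_C_add_X_mul x
    have h := map_upper_torus φ 1 ((2 + X * 1)⁻¹ * z)
    rw [show (2 + X * 1 : F⟦X⟧) * X * 1 * ((2 + X * 1)⁻¹ * z) = X * z by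
      linear_combination X * z * hinv] at h
    rw [map_upper_add, hu, h, one_mul]
  · intro x
    obtain ⟨a, z, rfl⟩ := exists_eq_C_add_X_mul x
    have h := map_lower_torus φ 1 ((2 + X * 1)⁻¹ * z)
    rw [show (2 + X * 1 : F⟦X⟧) * X * 1 * ((2 + X * 1)⁻¹ * z) = X * z by
      linear_combination X * z * hinv] at h
    rw [map_lower_add, hl, h, one_mul]

/-- In characteristic 2 the torus relations with `v = 1` kill only multiples of `X ^ 2`. The
relation `upper_mul_lower` with constant entries then matters only to first order in `X`, and signs
disappear. -/
theorem map_torus_C [CharP F 2] (hu : ∀ a, φ (upper (C a)) = 1) (hl : ∀ a, φ (lower (C a)) = 1)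
    (a b : F) : φ (torus (C (a * b))) =
      φ (upper (X * C (a ^ 2 * b))) * φ (lower (X * C (a * b ^ 2))) := by
  have h2 : (2 : F⟦X⟧) = 0 := by
    rw [← map_ofNat (C : F →+* F⟦X⟧), CharTwo.two_eq_zero, map_zero]
  have hX2u : ∀ z, φ (upper (X ^ 2 * z)) = 1 := fun z ↦ by
    rw [← map_upper_torus φ 1 z]; congr 2; linear_combination (-X * z) * h2
  have hX2l : ∀ z, φ (lower (X ^ 2 * z)) = 1 := fun z ↦ by
    rw [← map_lower_torus φ 1 z]; congr 2; linear_combination (-X * z) * h2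
  have key : ∀ s : F, ∃ w, (1 + X * C s)⁻¹ = 1 + X * C s + X ^ 2 * w := fun s ↦ by
    have h := one_add_X_mul_inv (C s)
    refine ⟨C s ^ 2 * (1 + X * C s)⁻¹, ?_⟩
    linear_combination (1 - X * C s) * h - X * C s * h2
  obtain ⟨w, hw⟩ := key (a * b)
  have h := congrArg φ (upper_mul_lower (C a) (C b))
  rw [← map_mul, hw] at h
  rw [show C b * (1 + X * C (a * b) + X ^ 2 * w) = C b + X * C (a * b ^ 2) + X ^ 2 * (C b * w) by
      simp only [map_mul, map_pow]; ring,
    show C a * (1 + X * C (a * b) + X ^ 2 * w) = C a + X * C (a ^ 2 * b) + X ^ 2 * (C a * w) by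
      simp only [map_mul, map_pow]; ring] at h
  simp only [map_mul φ, map_upper_add, map_lower_add, hX2u, hX2l, hu, hl, one_mul, mul_one] at h
  have hsu : ∀ s, φ (upper (X * C s)) * φ (upper (X * C s)) = 1 := fun s ↦ by
    rw [← map_upper_add, ← hu 0]; congr 2
    rw [map_zero]; linear_combination X * C s * h2
  have hsl : ∀ s, φ (lower (X * C s)) * φ (lower (X * C s)) = 1 := fun s ↦ by
    rw [← map_lower_add, ← hl 0]; congr 2
    rw [map_zero]; linear_combination X * C s * h2
  have h' := congrArg (· * (φ (upper (X * C (a ^ 2 * b))) * φ (lower (X * C (a * b ^ 2))))) h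
  simp only [one_mul] at h'
  rw [h', show ∀ l t u : A, l * t * u * (u * l) = t * (u * u) * (l * l) by intros; ac_rfl,
    hsu, hsl, mul_one, mul_one]

/-- By `map_torus_C` the value on the torus depends only on `a * b`; comparing `(a, b)` with `(1, a
* b)` relates `α` to `β` through `c = a ^ 2 + a`. Two distinct nonzero values of `c` force `β` to
vanish on multiples of all squares by a fixed nonzero constant, which is the whole field. -/
theorem hom_eq_one_of_charTwo [Finite F] [CharP F 2] (hF : 5 ≤ Nat.card F)
    (hu : ∀ a, φ (upper (C a)) = 1) (hl : ∀ a, φ (lower (C a)) = 1) : φ = 1 := by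
  have h2 : (2 : F⟦X⟧) = 0 := by
    rw [← map_ofNat (C : F →+* F⟦X⟧), CharTwo.two_eq_zero, map_zero]
  set α : F → A := fun s ↦ φ (upper (X * C s)) with hα
  set β : F → A := fun s ↦ φ (lower (X * C s)) with hβ
  have αadd : ∀ s r, α (s + r) = α s * α r := fun s r ↦ by
    simp only [hα]; rw [← map_upper_add]; congr 2; rw [map_add]; ring
  have βadd : ∀ s r, β (s + r) = β s * β r := fun s r ↦ by
    simp only [hβ]; rw [← map_lower_add]; congr 2; rw [map_add]; ring
  have α0 : α 0 = 1 := by have := αadd 0 0; rw [add_zero] at this; exact (mul_eq_left.1 this.symm)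
  have β0 : β 0 = 1 := by have := βadd 0 0; rw [add_zero] at this; exact (mul_eq_left.1 this.symm)
  have αα : ∀ s, α s * α s = 1 := fun s ↦ by rw [← αadd, CharTwo.add_self_eq_zero, α0]
  have ββ : ∀ s, β s * β s = 1 := fun s ↦ by rw [← βadd, CharTwo.add_self_eq_zero, β0]
  have rel : ∀ a b : F, α ((a ^ 2 + a) * b) = β ((a ^ 2 + a) * b ^ 2) := fun a b ↦ by
    have h1 := map_torus_C φ hu hl a b
    have h3 := map_torus_C φ hu hl 1 (a * b)
    rw [one_mul, h1] at h3
    change α _ * β _ = α _ * β _ at h3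
    rw [add_mul, add_mul, αadd, βadd]
    rw [show (1 : F) ^ 2 * (a * b) = a * b by ring,
      show 1 * (a * b) ^ 2 = a ^ 2 * b ^ 2 by ring] at h3
    calc α (a ^ 2 * b) * α (a * b)
        = (α (a ^ 2 * b) * β (a * b ^ 2)) * (α (a * b) * β (a * b ^ 2)) := by
          rw [mul_mul_mul_comm, ββ, mul_one]
      _ = _ := by rw [h3, mul_mul_mul_comm, αα, one_mul]
  have rel' : ∀ a x : F, a ^ 2 + a ≠ 0 → α x = β (x ^ 2 / (a ^ 2 + a)) := fun a x ha ↦ by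
    have := rel a (x / (a ^ 2 + a))
    rw [mul_div_cancel₀ _ ha] at this
    rw [this]; congr 1; field_simp
  have hfac : ∀ a b : F, a ^ 2 + a = b ^ 2 + b → a = b ∨ a = b + 1 := fun a b h ↦ by
    have : (a - b) * (a - (b + 1)) = 0 := by
      linear_combination h + (b ^ 2 + b - a * b - a) * (CharTwo.two_eq_zero (R := F))
    rcases mul_eq_zero.1 this with h | h
    · exact Or.inl (sub_eq_zero.1 h)
    · exact Or.inr (sub_eq_zero.1 h)
  obtain ⟨a, ha⟩ : ∃ a : F, a ∉ ({0, 1} : Set F) := by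
    by_contra! h
    have := Set.ncard_le_ncard (fun x _ ↦ h x : (Set.univ : Set F) ⊆ _) (Set.toFinite _)
    rw [Set.ncard_univ] at this
    have := Set.ncard_insert_le (0 : F) {1}
    rw [Set.ncard_singleton] at this
    omega
  -- The fibers of `a ↦ a ^ 2 + a` are the pairs `a`, `a + 1`. Avoiding two of them, over 0 and over
  -- the value at `a`, takes a fifth element.
  obtain ⟨b, hb⟩ : ∃ b : F, b ∉ ({0, 1, a, a + 1} : Set F) := by
    by_contra! h
    have := Set.ncard_le_ncard (fun x _ ↦ h x : (Set.univ : Set F) ⊆ _) (Set.toFinite _)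
    rw [Set.ncard_univ] at this
    have := Set.ncard_insert_le (0 : F) {1, a, a + 1}
    have := Set.ncard_insert_le (1 : F) {a, a + 1}
    have := Set.ncard_insert_le a {a + 1}
    rw [Set.ncard_singleton] at this
    omega
  simp only [Set.mem_insert_iff, Set.mem_singleton_iff, not_or] at ha hb
  have hca : a ^ 2 + a ≠ 0 := fun h ↦ by
    rcases hfac a 0 (by simpa using h) with h | h
    · exact ha.1 h
    · exact ha.2 (by simpa using h)
  have hcb : b ^ 2 + b ≠ 0 := fun h ↦ by
    rcases hfac b 0 (by simpa using h) with h | h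
    · exact hb.1 h
    · exact hb.2.1 (by simpa using h)
  have hab : b ^ 2 + b ≠ a ^ 2 + a := fun h ↦ by
    rcases hfac b a h with h | h
    · exact hb.2.2.1 h
    · exact hb.2.2.2 h
  have hc : (a ^ 2 + a)⁻¹ + (b ^ 2 + b)⁻¹ ≠ 0 := fun h ↦ by
    rw [CharTwo.add_eq_zero] at h
    exact hab (inv_injective h).symm
  have βone : ∀ y, β y = 1 := fun y ↦ by
    obtain ⟨x, hx⟩ : IsSquare (y / ((a ^ 2 + a)⁻¹ + (b ^ 2 + b)⁻¹)) := by
      have := Fintype.ofFinite F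
      exact FiniteField.isSquare_of_char_two (ringChar.eq F 2) _
    have h := rel' a x hca
    rw [rel' b x hcb] at h
    have h' : β (x ^ 2 / (b ^ 2 + b) + x ^ 2 / (a ^ 2 + a)) = 1 := by rw [βadd, h, ββ]
    rw [← h']; congr 1
    rw [div_eq_iff hc] at hx
    rw [hx]; ring
  have αone : ∀ x, α x = 1 := fun x ↦ by rw [rel' a x hca, βone]
  apply hom_eq_one_of_upper_lower
  · intro x
    obtain ⟨s, z, rfl⟩ := exists_eq_C_add_X_mul x
    obtain ⟨r, w, rfl⟩ := exists_eq_C_add_X_mul z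
    have h := map_upper_torus φ 1 w
    rw [show (2 + X * 1 : F⟦X⟧) * X * 1 * w = X * (X * w) by
      linear_combination X * w * h2] at h
    rw [mul_add, map_upper_add, map_upper_add, hu, h, one_mul, mul_one]
    exact αone r
  · intro x
    obtain ⟨s, z, rfl⟩ := exists_eq_C_add_X_mul x
    obtain ⟨r, w, rfl⟩ := exists_eq_C_add_X_mul z
    have h := map_lower_torus φ 1 w
    rw [show (2 + X * 1 : F⟦X⟧) * X * 1 * w = X * (X * w) by
      linear_combination X * w * h2] at h
    rw [mul_add, map_lower_add, map_lower_add, hl, h, one_mul, mul_one]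
    exact βone r

theorem hom_eq_one [Finite F] (h3 : 3 ≤ Nat.card F) (h4 : Nat.card F ≠ 4)
    (hu : ∀ a, φ (upper (C a)) = 1) (hl : ∀ a, φ (lower (C a)) = 1) : φ = 1 := by
  by_cases h2 : (2 : F) = 0
  · have : CharP F 2 := CharTwo.of_one_ne_zero_of_two_eq_zero one_ne_zero h2
    refine hom_eq_one_of_charTwo φ ?_ hu hl
    have hne : Nat.card F ≠ 3 := fun h ↦ by
      have := Fintype.ofFinite F
      have hc := Nat.cast_card_eq_zero F
      rw [← Nat.card_eq_fintype_card, h] at hc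
      push_cast at hc
      exact one_ne_zero (α := F) (by linear_combination hc - h2)
    omega
  · exact hom_eq_one_of_two_ne_zero φ h2 hu hl

end Hom

/-! ### Finite quotients and density -/

/-- Reduction modulo `X ^ N`. -/
noncomputable def reduction (F : Type*) [Field F] (N : ℕ) :
    unip F →* SpecialLinearGroup (Fin 2) (F⟦X⟧ ⧸ Ideal.span {(X : F⟦X⟧) ^ N}) :=
  (Matrix.SpecialLinearGroup.map (Ideal.Quotient.mk _)).comp (unip F).subtype

theorem reduction_eq_one_iff {N : ℕ} {g : unip F} :
    reduction F N g = 1 ↔ ∀ i j, (X : F⟦X⟧) ^ N ∣ (mat g - 1) i j := by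
  refine (Matrix.SpecialLinearGroup.ext_iff _ _).trans ?_
  refine forall_congr' fun i ↦ forall_congr' fun j ↦ ?_
  rw [← Ideal.mem_span_singleton, Matrix.sub_apply, ← Ideal.Quotient.eq]
  have : (1 : Matrix (Fin 2) (Fin 2) (F⟦X⟧ ⧸ Ideal.span {(X : F⟦X⟧) ^ N})) i j =
    Ideal.Quotient.mk _ ((1 : Matrix (Fin 2) (Fin 2) F⟦X⟧) i j) := by
    rw [Matrix.one_apply, Matrix.one_apply]; split_ifs <;> simp
  rw [← this]
  rfl

theorem finite_quotient_X_pow [Finite F] (N : ℕ) :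
    Finite (F⟦X⟧ ⧸ Ideal.span {(X : F⟦X⟧) ^ N}) := by
  refine Finite.of_injective
    (fun r (i : Fin N) ↦ coeff i (Function.surjInv Ideal.Quotient.mk_surjective r)) ?_
  intro r s h
  rw [← Function.surjInv_eq Ideal.Quotient.mk_surjective r,
    ← Function.surjInv_eq Ideal.Quotient.mk_surjective s, Ideal.Quotient.eq,
    Ideal.mem_span_singleton, X_pow_dvd_iff]
  intro m hm
  rw [map_sub, sub_eq_zero]
  exact congrFun h ⟨m, hm⟩

/-- Write the matrix as `1 + n`. Modulo `X` the matrix `n` is strictly triangular, so `n ^ 2` is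
divisible by `X`; Frobenius turns the `p ^ m`-th power into `1 + n ^ p ^ m`. -/
theorem isPGroup_range_reduction (p : ℕ) [Fact p.Prime] [CharP F p] (N : ℕ) :
    IsPGroup p (reduction F N).range := by
  rintro ⟨_, g, rfl⟩
  obtain ⟨m, hm⟩ : ∃ m, 2 * N < p ^ m :=
    pow_unbounded_of_one_lt _ (Fact.out : p.Prime).one_lt
  refine ⟨m, Subtype.ext ?_⟩
  change reduction F N g ^ p ^ m = 1
  rw [← map_pow, reduction_eq_one_iff]
  obtain ⟨h1, h2, h3⟩ := mat_entries g
  set n : Matrix (Fin 2) (Fin 2) F⟦X⟧ := mat g - 1 with hn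
  obtain ⟨a, ha⟩ := X_dvd_iff.2 (show constantCoeff (n 0 0) = 0 by simp [hn, h1])
  obtain ⟨d, hd⟩ := X_dvd_iff.2 (show constantCoeff (n 1 1) = 0 by simp [hn, h2])
  obtain ⟨c, hc⟩ := X_dvd_iff.2 (show constantCoeff (n 1 0) = 0 by simp [hn, h3])
  have hsq : ∃ n' : Matrix (Fin 2) (Fin 2) F⟦X⟧, n ^ 2 = (X : F⟦X⟧) • n' := by
    refine ⟨!![X * a ^ 2 + n 0 1 * c, a * n 0 1 + n 0 1 * d;
      X * c * a + X * d * c, c * n 0 1 + X * d ^ 2], ?_⟩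
    ext i j : 1
    rw [pow_two, Matrix.mul_apply, Fin.sum_univ_two]
    fin_cases i <;> fin_cases j <;> simp [ha, hd, hc] <;> ring
  obtain ⟨n', hn'⟩ := hsq
  have : CharP F⟦X⟧ p := charP_of_injective_algebraMap (algebraMap F F⟦X⟧).injective p
  have hg : mat (g ^ p ^ m) - 1 = n ^ p ^ m := by
    rw [mat_pow, show mat g = 1 + n by rw [hn, add_sub_cancel],
      add_pow_char_pow_of_commute _ _ (Commute.one_left n), one_pow, add_sub_cancel_left]
  intro i j
  rw [hg, ← Nat.add_sub_cancel' hm.le, pow_add, pow_mul, hn', smul_pow, smul_mul_assoc,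
    Matrix.smul_apply, smul_eq_mul]
  exact dvd_mul_right _ _

/-- The unitriangular matrices with constant entries generate `unip F` topologically. -/
theorem eq_top_of_upper_lower [Finite F] (h3 : 3 ≤ Nat.card F) (h4 : Nat.card F ≠ 4)
    (S : Subgroup (unip F)) (hu : ∀ a, upper (C a) ∈ S) (hl : ∀ a, lower (C a) ∈ S) (N : ℕ)
    (hS : ∀ g : unip F, (∀ i j, (X : F⟦X⟧) ^ N ∣ (mat g - 1) i j) → g ∈ S) : S = ⊤ := by
  obtain ⟨p, hp⟩ := CharP.exists F
  have : Fact p.Prime := ⟨CharP.char_is_prime F p⟩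
  have := finite_quotient_X_pow (F := F) N
  refine Subgroup.eq_top_of_forall_commGroup_hom (isPGroup_range_reduction (F := F) p N)
    (reduction F N).rangeRestrict (reduction F N).rangeRestrict_surjective S ?_ ?_
  · intro g hg
    rw [MonoidHom.ker_rangeRestrict, MonoidHom.mem_ker, reduction_eq_one_iff] at hg
    exact hS g hg
  · intro A _ φ hφ
    exact hom_eq_one φ h3 h4 (fun a ↦ hφ (hu a)) (fun a ↦ hφ (hl a))

/-! ### Flags as matrices -/

/-- A matrix over `F⟦X⟧` whose columns encode a point and a line incident with it. -/
def IsFlag (g : Matrix (Fin 2) (Fin 2) F⟦X⟧) : Prop :=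
  constantCoeff (g 0 0) = 1 ∧ constantCoeff (g 1 1) = 1 ∧ constantCoeff (g 1 0) = 0 ∧
    coeff 1 g.det = 0

/-- The coordinates of the point of a flag. -/
noncomputable def ptCoord (g : Matrix (Fin 2) (Fin 2) F⟦X⟧) (i : ℕ) : F :=
  if i = 1 then coeff 1 (g 1 0)
  else if i % 4 = 0 then coeff 0 (g 0 1) * coeff (i / 4) (g 0 0) - coeff (i / 4) (g 0 1)
  else if i % 4 = 1 then
    coeff 0 (g 0 1) * coeff ((i + 3) / 4) (g 1 0) - coeff ((i + 3) / 4) (g 1 1)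
  else if i % 4 = 2 then coeff ((i + 2) / 4) (g 0 0)
  else coeff ((i + 5) / 4) (g 1 0)

/-- The coordinates of the line of a flag. -/
noncomputable def lnCoord (g : Matrix (Fin 2) (Fin 2) F⟦X⟧) (i : ℕ) : F :=
  if i = 1 then coeff 0 (g 0 1)
  else if i = 2 then coeff 1 (g 1 1)
  else if i % 4 = 0 then coeff (i / 4) (g 0 1)
  else if i % 4 = 1 then coeff ((i + 3) / 4) (g 1 1)
  else if i % 4 = 2 then
    coeff 1 (g 1 0) * coeff ((i - 2) / 4) (g 0 1) - coeff ((i + 2) / 4) (g 0 0)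
  else coeff 1 (g 1 0) * coeff ((i + 1) / 4) (g 1 1) - coeff ((i + 5) / 4) (g 1 0)

/-- The point of a flag. -/
noncomputable def pt (k : ℕ) (g : Matrix (Fin 2) (Fin 2) F⟦X⟧) : Fin k → F :=
  fun i ↦ ptCoord g (i + 1)

/-- The line of a flag. -/
noncomputable def ln (k : ℕ) (g : Matrix (Fin 2) (Fin 2) F⟦X⟧) : Fin k → F :=
  fun i ↦ lnCoord g (i + 1)

theorem coord_comp {k i : ℕ} (f : ℕ → F) (h1 : 1 ≤ i) (hk : i ≤ k) :
    coord (fun j : Fin k ↦ f (j + 1)) i = f i := by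
  rw [coord, dif_pos ⟨h1, hk⟩]
  simp only [Nat.sub_add_cancel h1]

theorem eq_of_coord {k : ℕ} {v w : Fin k → F} (h : ∀ i, 1 ≤ i → i ≤ k → coord v i = coord w i) :
    v = w := by
  ext ⟨i, hi⟩
  have := h (i + 1) (by omega) (by omega)
  simpa [coord, Nat.succ_le_of_lt hi] using this

theorem coord_pt {k i : ℕ} (g : Matrix (Fin 2) (Fin 2) F⟦X⟧) (h1 : 1 ≤ i) (hk : i ≤ k) :
    coord (pt k g) i = ptCoord g i :=
  coord_comp _ h1 hk

theorem coord_ln {k i : ℕ} (g : Matrix (Fin 2) (Fin 2) F⟦X⟧) (h1 : 1 ≤ i) (hk : i ≤ k) :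
    coord (ln k g) i = lnCoord g i :=
  coord_comp _ h1 hk

theorem exists_mod_four {i : ℕ} (hi : 4 ≤ i) :
    ∃ m, i = 4 * m + 4 ∨ i = 4 * m + 5 ∨ i = 4 * m + 6 ∨ i = 4 * m + 7 :=
  ⟨(i - 4) / 4, by omega⟩

section Formulas

variable (g : Matrix (Fin 2) (Fin 2) F⟦X⟧) (m : ℕ)

theorem ptCoord_one : ptCoord g 1 = coeff 1 (g 1 0) := rfl

theorem ptCoord_zero_mod : ptCoord g (4 * m + 4) =
    coeff 0 (g 0 1) * coeff (m + 1) (g 0 0) - coeff (m + 1) (g 0 1) := by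
  rw [ptCoord, if_neg (by omega), if_pos (by omega), show (4 * m + 4) / 4 = m + 1 by omega]

theorem ptCoord_one_mod : ptCoord g (4 * m + 5) =
    coeff 0 (g 0 1) * coeff (m + 2) (g 1 0) - coeff (m + 2) (g 1 1) := by
  rw [ptCoord, if_neg (by omega), if_neg (by omega), if_pos (by omega),
    show (4 * m + 5 + 3) / 4 = m + 2 by omega]

theorem ptCoord_two_mod : ptCoord g (4 * m + 2) = coeff (m + 1) (g 0 0) := by
  rw [ptCoord, if_neg (by omega), if_neg (by omega), if_neg (by omega), if_pos (by omega),
    show (4 * m + 2 + 2) / 4 = m + 1 by omega]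

theorem ptCoord_three_mod : ptCoord g (4 * m + 3) = coeff (m + 2) (g 1 0) := by
  rw [ptCoord, if_neg (by omega), if_neg (by omega), if_neg (by omega), if_neg (by omega),
    show (4 * m + 3 + 5) / 4 = m + 2 by omega]

theorem lnCoord_one : lnCoord g 1 = coeff 0 (g 0 1) := rfl

theorem lnCoord_two : lnCoord g 2 = coeff 1 (g 1 1) := rfl

theorem lnCoord_zero_mod : lnCoord g (4 * m + 4) = coeff (m + 1) (g 0 1) := by
  rw [lnCoord, if_neg (by omega), if_neg (by omega), if_pos (by omega),
    show (4 * m + 4) / 4 = m + 1 by omega]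

theorem lnCoord_one_mod : lnCoord g (4 * m + 5) = coeff (m + 2) (g 1 1) := by
  rw [lnCoord, if_neg (by omega), if_neg (by omega), if_neg (by omega), if_pos (by omega),
    show (4 * m + 5 + 3) / 4 = m + 2 by omega]

theorem lnCoord_two_mod : lnCoord g (4 * m + 6) =
    coeff 1 (g 1 0) * coeff (m + 1) (g 0 1) - coeff (m + 2) (g 0 0) := by
  rw [lnCoord, if_neg (by omega), if_neg (by omega), if_neg (by omega), if_neg (by omega),
    if_pos (by omega), show (4 * m + 6 + 2) / 4 = m + 2 by omega,
    show (4 * m + 6 - 2) / 4 = m + 1 by omega]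

theorem lnCoord_three_mod : lnCoord g (4 * m + 3) =
    coeff 1 (g 1 0) * coeff (m + 1) (g 1 1) - coeff (m + 2) (g 1 0) := by
  rw [lnCoord, if_neg (by omega), if_neg (by omega), if_neg (by omega), if_neg (by omega),
    if_neg (by omega), show (4 * m + 3 + 5) / 4 = m + 2 by omega,
    show (4 * m + 3 + 1) / 4 = m + 1 by omega]

end Formulas

theorem coeff_one_mul' (f g : F⟦X⟧) :
    coeff 1 (f * g) = coeff 0 f * coeff 1 g + coeff 1 f * coeff 0 g := by
  rw [PowerSeries.coeff_mul, Finset.Nat.antidiagonal_succ]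
  simp

theorem coeff_one_X_mul (f : F⟦X⟧) : coeff 1 (X * f) = coeff 0 f :=
  coeff_succ_X_mul 0 f

/-- For `i ≥ 3` one of the two `i`-th coordinates is defined by solving the `i`-th relation. For `i
= 2` the relation is exactly the vanishing of the linear term of the determinant. -/
theorem IsFlag.adj {k : ℕ} {g : Matrix (Fin 2) (Fin 2) F⟦X⟧} (hg : IsFlag g) :
    (D k F).Adj (Sum.inl (pt k g)) (Sum.inr (ln k g)) := by
  obtain ⟨ha, hd, hc, hdet⟩ := hg
  intro i hi hk
  rw [coord_pt g (by omega) hk, coord_ln g (by omega) hk, rhs]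
  split_ifs with h2 h3 h4
  · subst h2
    rw [coord_pt g (by omega) (by omega), coord_ln g (by omega) (by omega), ptCoord_one,
      lnCoord_one, lnCoord_two, ptCoord_two_mod g 0]
    rw [Matrix.det_fin_two, map_sub, coeff_one_mul', coeff_one_mul'] at hdet
    simp only [coeff_zero_eq_constantCoeff, ha, hd, hc] at hdet ⊢
    rw [zero_add]
    linear_combination hdet
  · subst h3
    rw [coord_pt g (by omega) (by omega), coord_ln g (by omega) (by omega), ptCoord_one,
      lnCoord_two, ptCoord_three_mod g 0, lnCoord_three_mod g 0]
    ring
  · rw [coord_pt g (by omega) (by omega), coord_ln g (by omega) (by omega), lnCoord_one]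
    obtain ⟨m, rfl | rfl | rfl | rfl⟩ := exists_mod_four (i := i) (by omega)
    · rw [ptCoord_zero_mod, lnCoord_zero_mod, show 4 * m + 4 - 2 = 4 * m + 2 by omega,
        ptCoord_two_mod]
      ring
    · rw [ptCoord_one_mod, lnCoord_one_mod, show 4 * m + 5 - 2 = 4 * m + 3 by omega,
        ptCoord_three_mod]
      ring
    · omega
    · omega
  · rw [coord_pt g (by omega) (by omega), coord_ln g (by omega) (by omega), ptCoord_one]
    obtain ⟨m, rfl | rfl | rfl | rfl⟩ := exists_mod_four (i := i) (by omega)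
    · omega
    · omega
    · rw [show 4 * m + 6 = 4 * (m + 1) + 2 by ring, ptCoord_two_mod,
        show 4 * (m + 1) + 2 = 4 * m + 6 by ring, lnCoord_two_mod,
        show 4 * m + 6 - 2 = 4 * m + 4 by omega, lnCoord_zero_mod]
      ring
    · rw [show 4 * m + 7 = 4 * (m + 1) + 3 by ring, ptCoord_three_mod, lnCoord_three_mod,
        show 4 * (m + 1) + 3 - 2 = 4 * m + 5 by omega, lnCoord_one_mod]
      ring

theorem IsFlag.mul {g : Matrix (Fin 2) (Fin 2) F⟦X⟧} (hg : IsFlag g) (h : unip F) :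
    IsFlag (g * mat h) := by
  obtain ⟨ha, hd, hc, hdet⟩ := hg
  obtain ⟨h1, h2, h3⟩ := mat_entries h
  refine ⟨?_, ?_, ?_, ?_⟩
  · simp [Matrix.mul_apply, Fin.sum_univ_two, *]
  · simp [Matrix.mul_apply, Fin.sum_univ_two, *]
  · simp [Matrix.mul_apply, Fin.sum_univ_two, *]
  · rw [Matrix.det_mul, det_mat, mul_one, hdet]

/-- The tighter bound on the entry `0 0` is what later allows a change of that entry from degree `(k
+ 2) / 4 + 1` on. -/
theorem pt_congr {k : ℕ} {g h : Matrix (Fin 2) (Fin 2) F⟦X⟧}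
    (h00 : ∀ m, 4 * m ≤ k + 2 → coeff m (g 0 0) = coeff m (h 0 0))
    (h01 : ∀ m, 4 * m ≤ k + 5 → coeff m (g 0 1) = coeff m (h 0 1))
    (h10 : ∀ m, 4 * m ≤ k + 5 → coeff m (g 1 0) = coeff m (h 1 0))
    (h11 : ∀ m, 4 * m ≤ k + 5 → coeff m (g 1 1) = coeff m (h 1 1)) : pt k g = pt k h := by
  apply eq_of_coord
  intro i h1 hk
  rw [coord_pt g h1 hk, coord_pt h h1 hk, ptCoord, ptCoord, h01 0 (by omega)]
  split_ifs
  · exact h10 1 (by omega)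
  · rw [h00 _ (by omega), h01 _ (by omega)]
  · rw [h10 _ (by omega), h11 _ (by omega)]
  · rw [h00 _ (by omega)]
  · rw [h10 _ (by omega)]

/-- The second column enters the point only through `coeff 0 (g 0 1)` times the first column minus
the second, which this column operation preserves. -/
theorem IsFlag.pt_mul_upper {g : Matrix (Fin 2) (Fin 2) F⟦X⟧} (hg : IsFlag g) (k : ℕ) (x : F) :
    pt k (g * mat (upper (C x))) = pt k g := by
  obtain ⟨ha, hd, hc, hdet⟩ := hg
  apply eq_of_coord
  intro i h1 hk
  rw [coord_pt _ h1 hk, coord_pt _ h1 hk, ptCoord, ptCoord]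
  simp only [Matrix.mul_apply, Fin.sum_univ_two, mat_upper]
  split_ifs <;> simp [ha, coeff_mul_C] <;> ring

/-- `coeff 1 (g 1 0)` grows by `x`, and this cancels the `x` times shifted second column added to
the first. -/
theorem IsFlag.ln_mul_lower {g : Matrix (Fin 2) (Fin 2) F⟦X⟧} (hg : IsFlag g) (k : ℕ) (x : F) :
    ln k (g * mat (lower (C x))) = ln k g := by
  obtain ⟨ha, hd, hc, hdet⟩ := hg
  apply eq_of_coord
  intro i h1 hk
  have key : ∀ (m : ℕ) (f : F⟦X⟧), coeff (m + 1) (f * (X * C x)) = coeff m f * x := fun m f ↦ by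
    rw [mul_left_comm, coeff_succ_X_mul, coeff_mul_C]
  have hc1 : coeff 1 ((g * mat (lower (C x))) 1 0) = coeff 1 (g 1 0) + x := by
    simp only [Matrix.mul_apply, Fin.sum_univ_two, mat_lower]
    have := key 0 (g 1 1)
    simp at this
    simp [this, hd]
  have h0 : ∀ j m, coeff (m + 1) ((g * mat (lower (C x))) j 0) =
      coeff (m + 1) (g j 0) + coeff m (g j 1) * x := fun j m ↦ by
    simp only [Matrix.mul_apply, Fin.sum_univ_two, mat_lower]
    simp [key]
  have h1' : ∀ j, (g * mat (lower (C x))) j 1 = g j 1 := fun j ↦ by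
    simp [Matrix.mul_apply, Fin.sum_univ_two, mat_lower]
  rw [coord_ln _ h1 hk, coord_ln _ h1 hk, lnCoord, lnCoord]
  rw [hc1, h1', h1']
  split_ifs
  · rfl
  · rfl
  · rfl
  · rfl
  · rw [show (i + 2) / 4 = (i - 2) / 4 + 1 by omega, h0]
    ring
  · rw [show (i + 5) / 4 = (i + 1) / 4 + 1 by omega, h0]
    ring

/-! ### Connecting flags with equal determinants -/

/-- The elements of `unip F` that move the point of every flag inside its component. -/
def stab (k : ℕ) (F : Type*) [Field F] : Subgroup (unip F) where
  carrier := {h | ∀ g : Matrix (Fin 2) (Fin 2) F⟦X⟧, IsFlag g →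
    (D k F).Reachable (Sum.inl (pt k g)) (Sum.inl (pt k (g * mat h)))}
  one_mem' := fun g _ ↦ by rw [mat_one, mul_one]
  mul_mem' := fun {a b} ha hb g hg ↦ by
    rw [mat_mul, ← mul_assoc]
    exact (ha g hg).trans (hb _ (hg.mul a))
  inv_mem' := fun {a} ha g hg ↦ by
    have := ha _ (hg.mul a⁻¹)
    rw [mul_assoc, ← mat_mul, inv_mul_cancel, mat_one, mul_one] at this
    exact this.symm

theorem stab_eq_top [Finite F] (h3 : 3 ≤ Nat.card F) (h4 : Nat.card F ≠ 4) (k : ℕ) :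
    stab k F = ⊤ := by
  refine eq_top_of_upper_lower h3 h4 _ (fun a g hg ↦ ?_) (fun a g hg ↦ ?_) (k + 2)
    (fun h hh g hg ↦ ?_)
  · rw [hg.pt_mul_upper]
  · have h1 := (hg.adj (k := k)).reachable
    have h2 := ((hg.mul (lower (C a))).adj (k := k)).reachable
    rw [hg.ln_mul_lower] at h2
    exact h1.trans h2.symm
  · have key : ∀ i j m, m < k + 2 → coeff m (g i j) = coeff m ((g * mat h) i j) := by
      intro i j m hm
      have hdvd : (X : F⟦X⟧) ^ (k + 2) ∣ (g * mat h) i j - g i j := by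
        have : (g * mat h) i j - g i j = (g * (mat h - 1)) i j := by
          rw [mul_sub, mul_one, Matrix.sub_apply]
        rw [this, Matrix.mul_apply]
        exact Finset.dvd_sum fun l _ ↦ (hh l j).mul_left _
      have := X_pow_dvd_iff.1 hdvd m hm
      rw [map_sub, sub_eq_zero] at this
      exact this.symm
    rw [pt_congr (fun m hm ↦ key 0 0 m (by omega)) (fun m hm ↦ key 0 1 m (by omega))
      (fun m hm ↦ key 1 0 m (by omega)) (fun m hm ↦ key 1 1 m (by omega))]

/-- The quotient `g⁻¹ * g'`, written with the adjugate, has determinant one and is upper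
unitriangular modulo `X`, so it belongs to `unip F`. -/
theorem reachable_of_det_eq [Finite F] (h3 : 3 ≤ Nat.card F) (h4 : Nat.card F ≠ 4) (k : ℕ)
    {g g' : Matrix (Fin 2) (Fin 2) F⟦X⟧} (hg : IsFlag g) (hg' : IsFlag g')
    (hdet : g.det = g'.det) :
    (D k F).Reachable (Sum.inl (pt k g)) (Sum.inl (pt k g')) := by
  have hc0 : constantCoeff g.det = 1 := by
    obtain ⟨ha, hd, hc, -⟩ := hg
    simp [Matrix.det_fin_two, ha, hd, hc]
  have hne : constantCoeff g.det ≠ 0 := by rw [hc0]; exact one_ne_zero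
  have hinv : g.det * g.det⁻¹ = 1 := PowerSeries.mul_inv_cancel _ hne
  have hi0 : constantCoeff (g.det)⁻¹ = 1 := by
    have := congrArg constantCoeff hinv
    rwa [map_mul, hc0, one_mul, map_one] at this
  set n : Matrix (Fin 2) (Fin 2) F⟦X⟧ := g.det⁻¹ • (g.adjugate * g') with hn
  have hgn : g * n = g' := by
    rw [hn, Matrix.mul_smul, ← mul_assoc, Matrix.mul_adjugate, Matrix.smul_mul, one_mul, smul_smul,
      mul_comm, hinv, one_smul]
  have hndet : n.det = 1 := by
    have := congrArg Matrix.det hgn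
    rw [Matrix.det_mul, ← hdet] at this
    calc n.det = (g.det * g.det⁻¹) * n.det := by rw [hinv, one_mul]
      _ = g.det⁻¹ * (g.det * n.det) := by ring
      _ = 1 := by rw [this, mul_comm, hinv]
  obtain ⟨ha, hd, hc, -⟩ := id hg
  obtain ⟨ha', hd', hc', -⟩ := hg'
  have hentry : ∀ i j, constantCoeff (n i j) =
      constantCoeff (g.adjugate i 0) * constantCoeff (g' 0 j) +
        constantCoeff (g.adjugate i 1) * constantCoeff (g' 1 j) := fun i j ↦ by
    rw [hn, Matrix.smul_apply, smul_eq_mul, map_mul, hi0, one_mul, Matrix.mul_apply,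
      Fin.sum_univ_two, map_add, map_mul, map_mul]
  rw [Matrix.adjugate_fin_two] at hentry
  have hmem : ofMat n hndet (by rw [hentry]; simp [hd, ha', hc'])
      (by rw [hentry]; simp [hc, ha, hd']) (by rw [hentry]; simp [hc, hc']) ∈ stab k F := by
    rw [stab_eq_top h3 h4]; trivial
  have := hmem g hg
  rwa [mat_ofMat, hgn] at this

/-- Flags whose determinants agree to order `(k + 2) / 4` have points in the same component. -/
theorem reachable_of_coeff_det_eq [Finite F] (h3 : 3 ≤ Nat.card F) (h4 : Nat.card F ≠ 4) (k : ℕ)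
    {g g' : Matrix (Fin 2) (Fin 2) F⟦X⟧} (hg : IsFlag g) (hg' : IsFlag g')
    (hdet : ∀ m ≤ (k + 2) / 4, coeff m g.det = coeff m g'.det) :
    (D k F).Reachable (Sum.inl (pt k g)) (Sum.inl (pt k g')) := by
  set t := (k + 2) / 4 with ht
  have hc0 : constantCoeff g'.det = 1 := by
    obtain ⟨ha, hd, hc, -⟩ := hg'
    simp [Matrix.det_fin_two, ha, hd, hc]
  have hinv : g'.det * g'.det⁻¹ = 1 :=
    PowerSeries.mul_inv_cancel _ (by rw [hc0]; exact one_ne_zero)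
  obtain ⟨r, hr⟩ : (X : F⟦X⟧) ^ (t + 1) ∣ g.det - g'.det := X_pow_dvd_iff.2 fun m hm ↦ by
    rw [map_sub, hdet m (by omega), sub_self]
  set u : F⟦X⟧ := 1 + X ^ (t + 1) * (r * g'.det⁻¹) with hu
  have hdu : g.det = g'.det * u := by
    rw [hu]; linear_combination hr - X ^ (t + 1) * r * hinv
  have hu0 : constantCoeff u = 1 := by simp [hu]
  -- Scaling the first column by the ratio `u` of the determinants equalizes them. The point does
  -- not notice: `0 0` changes from degree `t + 1` on, and `1 0`, being divisible by `X`, only from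
  -- degree `t + 2` on.
  set n : Matrix (Fin 2) (Fin 2) F⟦X⟧ := !![g' 0 0 * u, g' 0 1; g' 1 0 * u, g' 1 1] with hn
  have hdn : n.det = g.det := by
    rw [hdu, hn, Matrix.det_fin_two_of, Matrix.det_fin_two]; ring
  have hnf : IsFlag n := by
    refine ⟨?_, hg'.2.1, ?_, ?_⟩
    · simp [hn, hu0, hg'.1]
    · simp [hn, hg'.2.2.1]
    · rw [hdn, hg.2.2.2]
  have hpt : pt k n = pt k g' := by
    refine pt_congr (fun m hm ↦ ?_) (fun m hm ↦ rfl) (fun m hm ↦ ?_) (fun m hm ↦ rfl)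
    · have : X ^ (t + 1) ∣ n 0 0 - g' 0 0 := ⟨g' 0 0 * (r * g'.det⁻¹), by simp [hn, hu]; ring⟩
      have := X_pow_dvd_iff.1 this m (by omega)
      rwa [map_sub, sub_eq_zero] at this
    · obtain ⟨c, hc⟩ := X_dvd_iff.2 hg'.2.2.1
      have : X ^ (t + 2) ∣ n 1 0 - g' 1 0 := ⟨c * (r * g'.det⁻¹), by simp [hn, hu, hc]; ring⟩
      have := X_pow_dvd_iff.1 this m (by omega)
      rwa [map_sub, sub_eq_zero] at this
  rw [← hpt]
  exact reachable_of_det_eq h3 h4 k hg hnf hdn.symm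

/-! ### Flags through vertices and the determinant invariant -/

/-- A flag through a given vertex. -/
noncomputable def flagOf {k : ℕ} : (Fin k → F) ⊕ (Fin k → F) → Matrix (Fin 2) (Fin 2) F⟦X⟧
  -- A point is paired with its neighbour having `l_1 = 0`, a line with its neighbour having `p_1 =
  -- 0`, so all products vanish. Coefficients beyond the `k` coordinates are zero by the default of
  -- `coord`.
  | Sum.inl p => !![
      PowerSeries.mk fun m ↦ if m = 0 then 1 else coord p (4 * m - 2),
      PowerSeries.mk fun m ↦ if m = 0 then 0 else -coord p (4 * m);
      PowerSeries.mk fun m ↦ if m = 0 then 0 else if m = 1 then coord p 1 else coord p (4 * m - 5),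
      PowerSeries.mk fun m ↦
        if m = 0 then 1 else if m = 1 then -coord p 2 else -coord p (4 * m - 3)]
  | Sum.inr l => !![
      PowerSeries.mk fun m ↦ if m = 0 then 1 else -coord l (4 * m - 2),
      PowerSeries.mk fun m ↦ if m = 0 then coord l 1 else coord l (4 * m);
      PowerSeries.mk fun m ↦ if m = 0 then 0 else if m = 1 then 0 else -coord l (4 * m - 5),
      PowerSeries.mk fun m ↦ if m = 0 then 1 else if m = 1 then coord l 2 else coord l (4 * m - 3)]

theorem isFlag_flagOf {k : ℕ} (v : (Fin k → F) ⊕ (Fin k → F)) : IsFlag (flagOf v) := by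
  rcases v with p | l
  · refine ⟨?_, ?_, ?_, ?_⟩
    · simp [flagOf, ← coeff_zero_eq_constantCoeff_apply]
    · simp [flagOf, ← coeff_zero_eq_constantCoeff_apply]
    · simp [flagOf, ← coeff_zero_eq_constantCoeff_apply]
    · rw [Matrix.det_fin_two, map_sub, coeff_one_mul', coeff_one_mul']
      simp only [flagOf, Matrix.of_apply, Matrix.cons_val', Matrix.cons_val_zero, Matrix.cons_val_one,
        Matrix.cons_val_fin_one, coeff_mk]
      simp
  · refine ⟨?_, ?_, ?_, ?_⟩
    · simp [flagOf, ← coeff_zero_eq_constantCoeff_apply]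
    · simp [flagOf, ← coeff_zero_eq_constantCoeff_apply]
    · simp [flagOf, ← coeff_zero_eq_constantCoeff_apply]
    · rw [Matrix.det_fin_two, map_sub, coeff_one_mul', coeff_one_mul']
      simp only [flagOf, Matrix.of_apply, Matrix.cons_val', Matrix.cons_val_zero, Matrix.cons_val_one,
        Matrix.cons_val_fin_one, coeff_mk]
      simp

theorem exists_mod_four' {i : ℕ} (hi : 1 ≤ i) :
    i = 1 ∨ ∃ m, i = 4 * m + 2 ∨ i = 4 * m + 3 ∨ i = 4 * m + 4 ∨ i = 4 * m + 5 := by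
  by_cases h : i = 1
  · exact Or.inl h
  · exact Or.inr ⟨(i - 2) / 4, by omega⟩

theorem pt_flagOf_inl {k : ℕ} (p : Fin k → F) : pt k (flagOf (Sum.inl p)) = p := by
  apply eq_of_coord
  intro i h1 hk
  rw [coord_pt _ h1 hk]
  obtain rfl | ⟨m, rfl | rfl | rfl | rfl⟩ := exists_mod_four' h1
  · rw [ptCoord_one]
    simp [flagOf]
  · rw [ptCoord_two_mod]
    simp [flagOf, show 4 * (m + 1) - 2 = 4 * m + 2 by omega]
  · rw [ptCoord_three_mod]
    simp [flagOf, show 4 * (m + 2) - 5 = 4 * m + 3 by omega]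
  · rw [ptCoord_zero_mod, coeff_zero_eq_constantCoeff_apply]
    simp [flagOf, ← coeff_zero_eq_constantCoeff_apply, mul_add]
  · rw [ptCoord_one_mod]
    simp [flagOf, show 4 * (m + 2) - 3 = 4 * m + 5 by omega]

theorem ln_flagOf_inr {k : ℕ} (l : Fin k → F) : ln k (flagOf (Sum.inr l)) = l := by
  apply eq_of_coord
  intro i h1 hk
  rw [coord_ln _ h1 hk]
  obtain rfl | ⟨m, rfl | rfl | rfl | rfl⟩ := exists_mod_four' h1
  · rw [lnCoord_one]
    simp [flagOf]
  · rcases m with _ | m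
    · rw [lnCoord_two]
      simp [flagOf]
    · rw [show 4 * (m + 1) + 2 = 4 * m + 6 by ring, lnCoord_two_mod]
      simp [flagOf, show 4 * (m + 2) - 2 = 4 * m + 6 by omega]
  · rw [lnCoord_three_mod]
    simp [flagOf, show 4 * (m + 2) - 5 = 4 * m + 3 by omega]
  · rw [lnCoord_zero_mod]
    simp [flagOf, mul_add]
  · rw [lnCoord_one_mod]
    simp [flagOf, show 4 * (m + 2) - 3 = 4 * m + 5 by omega]

theorem reachable_pt_flagOf {k : ℕ} (v : (Fin k → F) ⊕ (Fin k → F)) :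
    (D k F).Reachable v (Sum.inl (pt k (flagOf v))) := by
  rcases v with p | l
  · rw [pt_flagOf_inl]
  · have := (isFlag_flagOf (Sum.inr l)).adj (k := k)
    rw [ln_flagOf_inr] at this
    exact this.symm.reachable

/-- Multiplying the flag of `p` by `upper (C (coord l 1))` and that of `l` by `lower (C (coord p
1))` preserves determinants, and both products encode the edge joining `p` and `l`. -/
theorem X_pow_dvd_det_sub {k : ℕ} {p l : Fin k → F} (h : Incident p l) :
    X ^ ((k + 2) / 4 + 1) ∣ (flagOf (Sum.inr l)).det - (flagOf (Sum.inl p)).det := by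
  have hrel : ∀ i, 2 ≤ i → i ≤ k → coord p i + coord l i = rhs i p l := h
  set t := (k + 2) / 4 with ht
  obtain ⟨ha, hd, hc, -⟩ := isFlag_flagOf (Sum.inl p)
  obtain ⟨ha', hd', hc', -⟩ := isFlag_flagOf (Sum.inr l)
  have r2 : 2 ≤ k → coord p 2 + coord l 2 = coord p 1 * coord l 1 := fun hk ↦ by
    rw [hrel 2 le_rfl hk, rhs, if_pos rfl]
  have r3 : 3 ≤ k → coord p 3 + coord l 3 = coord p 1 * coord l 2 := fun hk ↦ by
    rw [hrel 3 (by omega) hk, rhs, if_neg (by omega), if_pos rfl]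
  have r4 : ∀ m, 4 * m + 4 ≤ k → coord p (4 * m + 4) + coord l (4 * m + 4) =
      coord p (4 * m + 2) * coord l 1 := fun m hk ↦ by
    rw [hrel _ (by omega) hk, rhs, if_neg (by omega), if_neg (by omega), if_pos (by omega),
      show 4 * m + 4 - 2 = 4 * m + 2 by omega]
  have r5 : ∀ m, 4 * m + 5 ≤ k → coord p (4 * m + 5) + coord l (4 * m + 5) =
      coord p (4 * m + 3) * coord l 1 := fun m hk ↦ by
    rw [hrel _ (by omega) hk, rhs, if_neg (by omega), if_neg (by omega), if_pos (by omega),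
      show 4 * m + 5 - 2 = 4 * m + 3 by omega]
  have r6 : ∀ m, 4 * m + 6 ≤ k → coord p (4 * m + 6) + coord l (4 * m + 6) =
      coord p 1 * coord l (4 * m + 4) := fun m hk ↦ by
    rw [hrel _ (by omega) hk, rhs, if_neg (by omega), if_neg (by omega), if_neg (by omega),
      show 4 * m + 6 - 2 = 4 * m + 4 by omega]
  have r7 : ∀ m, 4 * m + 7 ≤ k → coord p (4 * m + 7) + coord l (4 * m + 7) =
      coord p 1 * coord l (4 * m + 5) := fun m hk ↦ by
    rw [hrel _ (by omega) hk, rhs, if_neg (by omega), if_neg (by omega), if_neg (by omega),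
      show 4 * m + 7 - 2 = 4 * m + 5 by omega]
  obtain ⟨c, hc⟩ := X_dvd_iff.2 hc
  -- the two flags become equal, to the relevant order, after passing to a common edge
  obtain ⟨ra, hra⟩ : X ^ (t + 1) ∣ flagOf (Sum.inr l) 0 0 +
      C (coord p 1) * X * flagOf (Sum.inr l) 0 1 - flagOf (Sum.inl p) 0 0 := by
    refine X_pow_dvd_iff.2 fun m hm ↦ ?_
    rw [map_sub, map_add, mul_assoc, coeff_C_mul]
    rcases m with _ | _ | m
    · simp [ha, ha']
    · rw [zero_add, coeff_one_X_mul]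
      simp [flagOf]
      linear_combination -r2 (by omega)
    · rw [coeff_succ_X_mul]
      simp [flagOf, show 4 * (m + 1 + 1) - 2 = 4 * m + 6 by omega,
        show 4 * (m + 1) = 4 * m + 4 by ring]
      linear_combination -r6 m (by omega)
  -- In degree `t` this entry would need coordinate `4 * t`, which may exceed `k`. The missing power
  -- of `X` comes from the entry `1 0`, by which it is multiplied in the determinant.
  obtain ⟨rb, hrb⟩ : X ^ t ∣ flagOf (Sum.inl p) 0 1 +
      C (coord l 1) * flagOf (Sum.inl p) 0 0 - flagOf (Sum.inr l) 0 1 := by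
    refine X_pow_dvd_iff.2 fun m hm ↦ ?_
    rw [map_sub, map_add, coeff_C_mul]
    rcases m with _ | m
    · simp [flagOf]
    · simp [flagOf,
        show 4 * (m + 1) = 4 * m + 4 by ring]
      linear_combination -r4 m (by omega)
  obtain ⟨rc, hrc⟩ : X ^ (t + 1) ∣ flagOf (Sum.inr l) 1 0 +
      C (coord p 1) * X * flagOf (Sum.inr l) 1 1 - flagOf (Sum.inl p) 1 0 := by
    refine X_pow_dvd_iff.2 fun m hm ↦ ?_
    rw [map_sub, map_add, mul_assoc, coeff_C_mul]
    rcases m with _ | _ | _ | m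
    · simp [hc, hc']
    · rw [zero_add, coeff_one_X_mul]
      simp [flagOf]
    · rw [zero_add, coeff_succ_X_mul]
      simp [flagOf]
      linear_combination -r3 (by omega)
    · rw [coeff_succ_X_mul]
      simp [flagOf, show 4 * (m + 1 + 1 + 1) - 5 = 4 * m + 7 by omega,
        show 4 * (m + 1 + 1) - 3 = 4 * m + 5 by omega]
      linear_combination -r7 m (by omega)
  obtain ⟨rd, hrd⟩ : X ^ (t + 1) ∣ flagOf (Sum.inl p) 1 1 +
      C (coord l 1) * flagOf (Sum.inl p) 1 0 - flagOf (Sum.inr l) 1 1 := by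
    refine X_pow_dvd_iff.2 fun m hm ↦ ?_
    rw [map_sub, map_add, coeff_C_mul]
    rcases m with _ | _ | m
    · simp [hd, hd', hc]
    · simp [flagOf]
      linear_combination -r2 (by omega)
    · simp [flagOf, show 4 * (m + 1 + 1) - 3 = 4 * m + 5 by omega,
        show 4 * (m + 1 + 1) - 5 = 4 * m + 3 by omega]
      linear_combination -r5 m (by omega)
  rw [Matrix.det_fin_two, Matrix.det_fin_two]
  refine ⟨ra * flagOf (Sum.inr l) 1 1 - rc * flagOf (Sum.inr l) 0 1
    - flagOf (Sum.inl p) 0 0 * rd + c * rb, ?_⟩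
  linear_combination flagOf (Sum.inr l) 1 1 * hra - flagOf (Sum.inr l) 0 1 * hrc
    - flagOf (Sum.inl p) 0 0 * hrd + flagOf (Sum.inl p) 1 0 * hrb + X ^ t * rb * hc

/-- The coefficients of the determinant that are constant on components. -/
noncomputable def inv (k : ℕ) (v : (Fin k → F) ⊕ (Fin k → F)) (j : Fin ((k + 2) / 4 - 1)) : F :=
  coeff (j + 2) (flagOf v).det

theorem inv_eq_of_incident {k : ℕ} {p l : Fin k → F} (h : Incident p l) :
    inv k (Sum.inl p) = inv k (Sum.inr l) := by
  ext ⟨j, hj⟩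
  have := X_pow_dvd_iff.1 (X_pow_dvd_det_sub h) (j + 2) (by omega)
  rw [map_sub, sub_eq_zero] at this
  exact this.symm

theorem inv_eq_of_walk {k : ℕ} {v w : (Fin k → F) ⊕ (Fin k → F)} (p : (D k F).Walk v w) :
    inv k v = inv k w := by
  induction p with
  | nil => rfl
  | @cons a b c h _ ih =>
    rw [← ih]
    rcases a with a | a <;> rcases b with b | b
    · exact h.elim
    · exact inv_eq_of_incident h
    · exact (inv_eq_of_incident h).symm
    · exact h.elim

theorem inv_surjective (k : ℕ) : Function.Surjective (inv k (F := F)) := by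
  intro s
  -- Only the coordinates 6, 10, 14, … are used, so the second row of the flag is `0, 1` and the
  -- determinant is the entry `0 0`. Coordinate 2 stays zero because it also enters `1 1`.
  let p : ℕ → F := fun i ↦
    if h : i % 4 = 2 ∧ 6 ≤ i ∧ (i + 2) / 4 - 2 < (k + 2) / 4 - 1 then
      s ⟨(i + 2) / 4 - 2, h.2.2⟩ else 0
  refine ⟨Sum.inl fun i ↦ p (i + 1), ?_⟩
  have hp : ∀ i, i % 4 ≠ 2 ∨ i = 2 → coord (fun j : Fin k ↦ p (j + 1)) i = 0 := by
    intro i hi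
    by_cases h : 1 ≤ i ∧ i ≤ k
    · rw [coord_comp p h.1 h.2]
      exact dif_neg (by omega)
    · exact dif_neg h
  ext ⟨j, hj⟩
  have h10 : flagOf (Sum.inl fun j : Fin k ↦ p (j + 1)) 1 0 = 0 := by
    ext m
    rcases m with _ | _ | m
    · simp [flagOf]
    · simp [flagOf, hp 1]
    · simp [flagOf, hp (4 * (m + 1 + 1) - 5) (by omega)]
  have h11 : flagOf (Sum.inl fun j : Fin k ↦ p (j + 1)) 1 1 = 1 := by
    ext m
    rcases m with _ | _ | m
    · simp [flagOf]
    · simp [flagOf, hp 2, coeff_one]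
    · simp [flagOf, hp (4 * (m + 1 + 1) - 3) (by omega), coeff_one]
  rw [inv, Matrix.det_fin_two, h10, h11, mul_zero, sub_zero, mul_one]
  have : coord (fun j : Fin k ↦ p (j + 1)) (4 * j + 6) = s ⟨j, hj⟩ := by
    rw [coord_comp p (by omega) (by omega)]
    simp only [p]
    rw [dif_pos (by omega)]
    congr 2
    omega
  simp [flagOf, show 4 * (j + 2) - 2 = 4 * j + 6 by omega, this]

theorem reachable_of_inv_eq [Finite F] (h3 : 3 ≤ Nat.card F) (h4 : Nat.card F ≠ 4) {k : ℕ}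
    {v w : (Fin k → F) ⊕ (Fin k → F)} (h : inv k v = inv k w) : (D k F).Reachable v w := by
  refine (reachable_pt_flagOf v).trans (SimpleGraph.Reachable.trans ?_ (reachable_pt_flagOf w).symm)
  have hv := isFlag_flagOf v
  have hw := isFlag_flagOf w
  refine reachable_of_coeff_det_eq h3 h4 k hv hw fun m hm ↦ ?_
  rcases m with _ | _ | m
  · simp [Matrix.det_fin_two, hv.1, hv.2.1, hv.2.2.1, hw.1, hw.2.1, hw.2.2.1]
  · exact hv.2.2.2.trans hw.2.2.2.symm
  · exact congrFun h ⟨m, by omega⟩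

theorem card_connectedComponent [Finite F] (h3 : 3 ≤ Nat.card F) (h4 : Nat.card F ≠ 4) (k : ℕ) :
    Nat.card (D k F).ConnectedComponent = Nat.card F ^ ((k + 2) / 4 - 1) := by
  let f : (D k F).ConnectedComponent → (Fin ((k + 2) / 4 - 1) → F) :=
    SimpleGraph.ConnectedComponent.lift (inv k) fun _ _ p _ ↦ inv_eq_of_walk p
  have hf : Function.Bijective f := by
    constructor
    · intro a b
      refine SimpleGraph.ConnectedComponent.ind₂ (fun v w h ↦ ?_) a b
      exact SimpleGraph.ConnectedComponent.sound (reachable_of_inv_eq h3 h4 h)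
    · intro s
      obtain ⟨v, hv⟩ := inv_surjective k s
      exact ⟨(D k F).connectedComponentMk v, hv⟩
  rw [Nat.card_congr (Equiv.ofBijective f hf), Nat.card_fun, Nat.card_fin]

end DGraph

theorem theoremS (q : ℕ) (hq : IsPrimePow q) (hq3 : 3 ≤ q) (hq4 : q ≠ 4)
    (F : Type*) [Field F] [Finite F] (hF : Nat.card F = q)
    (k t : ℕ) (hk : 2 ≤ k) (ht : t = (k + 2) / 4) :
    Nat.card (DGraph.D k F).ConnectedComponent = q ^ (t - 1) := by
  subst hF ht
  exact DGraph.card_connectedComponent hq3 hq4 k
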